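/- Let $S\subseteq\mathbb N$ be a numerical semigroup (a submonoid of $(\mathbb N,+)$ with finite complement). Its minimal generators are its atoms, i.e. the nonzero elements of $S$ that are not a sum of two nonzero elements of $S$; let $e$ be their number. For a minimal generator $n_i$, let $c_i$ be the least positive integer $c$ such that $c\,n_i$ lies in the submonoid generated by the other minimal generators (this exists whenever $e\ge 2$). A factorization of $m\in S$ is an expression of $m$ as a sum of minimal generators up to order, i.e. a vector $x\in\mathbb N^e$ with $\sum_i x_in_i=m$. Let $\nabla_m$ be the graph on the factorizations of $m$ in which two factorizations are adjacent when they have a minimal generator in common. The set $\mathrm{Betti}(S)$ of Betti elements consists of those $m\in S$ for which $\nabla_m$ has at least two connected components, and $S$ is called Betti divisible if $\mathrm{Betti}(S)$ is totally ordered by divisibility. **Theorem.** Let $S$ be a numerical semigroup, and let $(n_1,\dots,n_e)$ be an arrangement of its minimal generators such that $c_1n_1\le c_2n_2\le\cdots\le c_en_e$. Then $S$ is Betti divisible if and only if there are positive integers $a_1,\dots,a_e,f_1,\dots,f_e$ such that 1. $a_1,\dots,a_e$ are pairwise coprime; 2. $1=f_1=f_2\mid f_3\mid\cdots\mid f_e$;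 3. $\gcd(f_i,a_i)=1$ for every $i\in\{1,\dots,e\}$; 4. $n_i=f_i\prod_{j=1}^e a_j/a_i$ for every $i\in\{1,\dots,e\}$. Moreover, for any such integers, $a_i=c_i$ for every $i\in\{1,\dots,e\}$, and $$\mathrm{Betti}(S)=\Big\{f_i\prod_{j=1}^e c_j : i\in\{2,\dots,e\}\Big\}.$$ In the degenerate case $e=1$ (that is, $S=\mathbb N$), where $c_1$ is not defined, the ordering hypothesis is void, condition 2 reads $f_1=1$, the equality $a_1=c_1$ is not claimed, and the formula for $\mathrm{Betti}(S)$ reads $\mathrm{Betti}(S)=\varnothing$. -/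

import Mathlib

namespace NumSgp

/-- A submonoid `S` of `ℕ` is a numerical semigroup if its complement in `ℕ` is finite. -/
def IsNumericalSemigroup (S : AddSubmonoid ℕ) : Prop :=
  ((S : Set ℕ)ᶜ).Finite

/-- The set of minimal generators of `S`, that is, the atoms of `S`: the nonzero elements of `S`
which are not the sum of two nonzero elements of `S`. -/
def minGens (S : AddSubmonoid ℕ) : Set ℕ :=
  {a | a ∈ S ∧ a ≠ 0 ∧ ∀ b ∈ S, ∀ c ∈ S, a = b + c → b = 0 ∨ c = 0}

/-- `(n 0, …, n (e - 1))` is an arrangement of the minimal generators of `S`: each of them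
is listed exactly once. -/
def IsArrangement (S : AddSubmonoid ℕ) {e : ℕ} (n : Fin e → ℕ) : Prop :=
  Function.Injective n ∧ Set.range n = minGens S

/-- For a minimal generator `a` of `S`, the least positive integer `c` such that `c * a` belongs to
the monoid generated by the other minimal generators. (Such a `c` exists as soon as `S` has at
least two minimal generators; otherwise the value is `0` by convention.) -/
noncomputable def cConst (S : AddSubmonoid ℕ) (a : ℕ) : ℕ :=
  sInf {c : ℕ | 0 < c ∧ c * a ∈ AddSubmonoid.closure (minGens S \ {a})}

/-- The set `Z(m)` of factorizations of `m` as a sum of minimal generators of `S`; a factorization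
is recorded by the multiplicity of each minimal generator. -/
def factorizations (S : AddSubmonoid ℕ) (m : ℕ) : Set (minGens S →₀ ℕ) :=
  {x | x.sum (fun a k => k * (a : ℕ)) = m}

/-- The graph `∇_m`: its vertices are the factorizations of `m`, and two distinct factorizations
are joined by an edge when their dot product is nonzero. -/
def nabla (S : AddSubmonoid ℕ) (m : ℕ) : SimpleGraph (factorizations S m) :=
  SimpleGraph.fromRel (fun x y => x.1.sum (fun a k => k * y.1 a) ≠ 0)

/-- The Betti elements of `S`: the elements with at least two `R`-classes, the `R`-classes of `m`
being the connected components of `∇_m`. -/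
def betti (S : AddSubmonoid ℕ) : Set ℕ :=
  {m | m ∈ S ∧ Nontrivial (nabla S m).ConnectedComponent}

/-- `S` is Betti divisible if its Betti elements are totally ordered by divisibility. -/
def IsBettiDivisible (S : AddSubmonoid ℕ) : Prop :=
  ∀ b ∈ betti S, ∀ b' ∈ betti S, b ∣ b' ∨ b' ∣ b

/-- The conditions on `a`, `f` and `n` which describe the generators of a Betti divisible numerical
semigroup. Indices start at `0`, so that `f 0 = f 1 = 1` is the condition on the first two terms
of `f`. -/
structure IsBettiDivisibleData {e : ℕ} (n a f : Fin e → ℕ) : Prop where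
  a_pos : ∀ i, 0 < a i
  f_pos : ∀ i, 0 < f i
  pairwise_coprime : ∀ i j, i ≠ j → Nat.Coprime (a i) (a j)
  f_first : ∀ i : Fin e, (i : ℕ) ≤ 1 → f i = 1
  f_chain : ∀ i j : Fin e, i ≤ j → f i ∣ f j
  coprime_f_a : ∀ i, Nat.Coprime (f i) (a i)
  n_eq : ∀ i, n i = f i * ((∏ j, a j) / a i)

end NumSgp

namespace NumSgp

/-! Each `c_a * a` is a Betti element, since its factorization by `a` alone is isolated. If `S` is
Betti divisible, induction on `m` shows that the multiplicity of `b` in a factorization of `m` is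
fixed modulo `c_b` (`modEq`). Applied to `a * b`, this gives `c_a ∣ b` for `a ≠ b`. As the
generators have gcd 1, the `c_i` are pairwise coprime and `c_i * n_i = f_i * ∏ c_j`. The
divisibility order makes the `f_i` a chain, and the least Betti element, attained by two generators
(`exists_min`), gives `f = 1` at the first two indices. Conversely, `a_i` is coprime to `n_i` and
divides every other generator. This forces `a_i = c_i` (`eq_cConst`), and swapping generators inside
a factorization shows that the Betti elements are exactly the `c_i * n_i` (`betti_eq_range`). -/

variable {S : AddSubmonoid ℕ}

/-! ### Factorizations and the graph `∇_m`. -/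

/-- The element of `ℕ` of which `x` is a factorization. -/
noncomputable def weight (S : AddSubmonoid ℕ) : (minGens S →₀ ℕ) →ₗ[ℕ] ℕ :=
  Finsupp.linearCombination ℕ (fun a : minGens S => (a : ℕ))

theorem weight_single (a : minGens S) (k : ℕ) :
    weight S (Finsupp.single a k) = k * a := by
  simp [weight]

theorem mem_factorizations {m : ℕ} {x : minGens S →₀ ℕ} :
    x ∈ factorizations S m ↔ weight S x = m := by
  simp [factorizations, weight, Finsupp.linearCombination_apply]

theorem minGens_pos (a : minGens S) : 0 < (a : ℕ) :=
  Nat.pos_of_ne_zero a.2.2.1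

theorem weight_mem (x : minGens S →₀ ℕ) : weight S x ∈ S := by
  rw [weight, Finsupp.linearCombination_apply]
  exact S.sum_mem fun a _ => S.nsmul_mem a.2.1 _

theorem weight_add_erase (x : minGens S →₀ ℕ) (a : minGens S) :
    x a * a + weight S (x.erase a) = weight S x := by
  rw [← weight_single, ← map_add, Finsupp.single_add_erase]

theorem eq_zero_of_weight_eq_zero {x : minGens S →₀ ℕ} (h : weight S x = 0) : x = 0 := by
  ext a
  have h1 := weight_add_erase x a
  have h2 : x a * a = 0 := by omega
  simpa [(minGens_pos a).ne'] using h2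

theorem nabla_adj {m : ℕ} (x y : factorizations S m) :
    (nabla S m).Adj x y ↔ x ≠ y ∧ ∃ a, x.1 a ≠ 0 ∧ y.1 a ≠ 0 := by
  have key : ∀ x y : minGens S →₀ ℕ, x.sum (fun a k => k * y a) ≠ 0 ↔ ∃ a, x a ≠ 0 ∧ y a ≠ 0 := by
    intro x y
    simp [Finsupp.sum, Finset.sum_eq_zero_iff]
  rw [nabla, SimpleGraph.fromRel_adj, key, key]
  grind

theorem reachable_of_common {m : ℕ} {x y : factorizations S m} {a : minGens S}
    (hx : x.1 a ≠ 0) (hy : y.1 a ≠ 0) : (nabla S m).Reachable x y := by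
  by_cases h : x = y
  · rw [h]
  · exact ((nabla_adj x y).2 ⟨h, a, hx, hy⟩).reachable

theorem mem_betti_iff {m : ℕ} :
    m ∈ betti S ↔ ∃ x y : factorizations S m, ¬ (nabla S m).Reachable x y := by
  constructor
  · rintro ⟨-, h⟩
    obtain ⟨X, Y, hXY⟩ := h
    induction X using SimpleGraph.ConnectedComponent.ind with | _ x
    induction Y using SimpleGraph.ConnectedComponent.ind with | _ y
    exact ⟨x, y, fun h => hXY (SimpleGraph.ConnectedComponent.eq.2 h)⟩
  · rintro ⟨x, y, h⟩
    refine ⟨?_, (nabla S m).connectedComponentMk x, (nabla S m).connectedComponentMk y,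
      fun h' => h (SimpleGraph.ConnectedComponent.eq.1 h')⟩
    rw [← mem_factorizations.1 x.2]
    exact weight_mem _

/-- An element with an isolated factorization and another one is a Betti element. -/
theorem mem_betti_of_isolated {m : ℕ} {x y : minGens S →₀ ℕ} (hx : weight S x = m)
    (hy : weight S y = m) (hxy : x ≠ y)
    (h : ∀ z a, weight S z = m → x a ≠ 0 → z a ≠ 0 → z = x) : m ∈ betti S := by
  refine mem_betti_iff.2 ⟨⟨x, mem_factorizations.2 hx⟩, ⟨y, mem_factorizations.2 hy⟩, ?_⟩
  rintro ⟨w⟩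
  cases w with
  | nil => exact hxy rfl
  | cons hadj w =>
    rename_i z
    obtain ⟨hne, a, hxa, hza⟩ := (nabla_adj _ _).1 hadj
    exact hne (Subtype.ext (h z.1 a (mem_factorizations.1 z.2) hxa hza).symm)

/-! ### The constants `c_a` and their isolated factorizations. -/

theorem mem_closure_diff_iff (a : minGens S) (m : ℕ) :
    m ∈ AddSubmonoid.closure (minGens S \ {(a : ℕ)}) ↔ ∃ x, weight S x = m ∧ x a = 0 := by
  constructor
  · intro h
    induction h using AddSubmonoid.closure_induction with
    | mem b hb =>
      refine ⟨Finsupp.single ⟨b, hb.1⟩ 1, by simp [weight_single], ?_⟩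
      exact Finsupp.single_eq_of_ne fun h => hb.2 (by simp [h])
    | zero => exact ⟨0, by simp, rfl⟩
    | add _ _ _ _ h1 h2 =>
      obtain ⟨x, rfl, hx⟩ := h1
      obtain ⟨y, rfl, hy⟩ := h2
      exact ⟨x + y, by simp, by simp [hx, hy]⟩
  · rintro ⟨x, rfl, hx⟩
    rw [weight, Finsupp.linearCombination_apply]
    refine AddSubmonoid.sum_mem _ fun b hb => AddSubmonoid.nsmul_mem _
      (AddSubmonoid.subset_closure (Set.mem_sdiff_singleton.2 ⟨b.2, fun h => ?_⟩)) _
    rw [Finsupp.mem_support_iff, Subtype.ext h] at hb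
    exact hb hx

theorem cConst_le {a : minGens S} {k : ℕ} (hk : 0 < k) {x : minGens S →₀ ℕ}
    (hx : weight S x = k * a) (hxa : x a = 0) : cConst S a ≤ k :=
  Nat.sInf_le ⟨hk, (mem_closure_diff_iff a _).2 ⟨x, hx, hxa⟩⟩

theorem cConst_spec [Nontrivial (minGens S)] (a : minGens S) :
    0 < cConst S a ∧ ∃ x, weight S x = cConst S a * a ∧ x a = 0 := by
  have h : cConst S a ∈
      {c : ℕ | 0 < c ∧ c * (a : ℕ) ∈ AddSubmonoid.closure (minGens S \ {(a : ℕ)})} := by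
    obtain ⟨b, hb⟩ := exists_ne a
    -- The multiple `b * a` of `a` is also `a` copies of `b`.
    refine Nat.sInf_mem ⟨b, minGens_pos b, (mem_closure_diff_iff a _).2
      ⟨Finsupp.single b a, ?_, by simp [hb]⟩⟩
    rw [weight_single, mul_comm]
  exact ⟨h.1, (mem_closure_diff_iff a _).1 h.2⟩

/-- With fewer than `c_a` copies of `a`, the rest of `z` would factor a smaller positive multiple of
`a` without using `a`. -/
theorem eq_single_of_weight_eq {a : minGens S} {z : minGens S →₀ ℕ}
    (hz : weight S z = cConst S a * a) (hza : z a ≠ 0) :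
    z = Finsupp.single a (cConst S a) := by
  have h1 := weight_add_erase z a
  rw [hz] at h1
  have hle : cConst S a ≤ z a := by
    by_contra! hlt
    have h2 : weight S (z.erase a) = (cConst S a - z a) * a := by
      rw [Nat.sub_mul]; omega
    have := cConst_le (by omega) h2 Finsupp.erase_same
    omega
  have h3 := Nat.mul_le_mul_right (a : ℕ) hle
  have h4 : weight S (z.erase a) = 0 := by omega
  have h5 : z a = cConst S a := Nat.eq_of_mul_eq_mul_right (minGens_pos a) (by omega)
  rw [← Finsupp.single_add_erase a z, eq_zero_of_weight_eq_zero h4, h5, add_zero]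

theorem cConst_mul_mem_betti [Nontrivial (minGens S)] (a : minGens S) :
    cConst S a * a ∈ betti S := by
  obtain ⟨hc, y, hy, hya⟩ := cConst_spec a
  refine mem_betti_of_isolated (weight_single a _) hy ?_ ?_
  · rintro rfl
    simp at hya
    omega
  · intro z b hz hb hzb
    obtain rfl : a = b := by
      by_contra h
      exact hb (by simp [Ne.symm h])
    exact eq_single_of_weight_eq hz hzb

/-! ### Consequences of Betti divisibility. -/

/-- A multiple `k * m` of `m` equal to `c_a * a`, where `a` occurs in some factorization of `m`
but not in all of them, is `m` itself. -/
theorem eq_cConst_mul_of_dvd {m : ℕ} {x y : minGens S →₀ ℕ} (hx : weight S x = m)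
    (hy : weight S y = m) {a : minGens S} (hxa : x a ≠ 0) (hya : y a = 0)
    (hc : 0 < cConst S a) (hd : m ∣ cConst S a * a) : m = cConst S a * a := by
  obtain ⟨k, hk⟩ := hd
  have hk0 : k ≠ 0 := by
    rintro rfl
    have := Nat.mul_pos hc (minGens_pos a)
    omega
  -- `k • x` factors `c_a * a` and uses `a`, so it is the isolated factorization; hence `x` uses
  -- only `a`.
  have h1 : k • x = Finsupp.single a (cConst S a) := by
    apply eq_single_of_weight_eq
    · rw [map_nsmul, hx, hk, smul_eq_mul, mul_comm]
    · simp [hk0, hxa]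
  have h2 : x = Finsupp.single a (x a) := by
    ext b
    by_cases hb : a = b
    · subst hb; simp
    · have := DFunLike.congr_fun h1 b
      simp [Ne.symm hb, hk0] at this
      simp [Ne.symm hb, this]
  have h3 : m = x a * a := by rw [← hx, h2, weight_single]; simp
  have h4 := cConst_le (Nat.pos_of_ne_zero hxa) (hy.trans h3) hya
  refine Nat.dvd_antisymm ⟨k, hk⟩ ?_
  have h5 := Nat.mul_le_mul_right (a : ℕ) h4
  have h6 : m * 1 ≤ m * k := Nat.mul_le_mul_left _ (by omega)
  have : m = cConst S a * a := by omega
  rw [← this]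

theorem IsBettiDivisible.cConst_mul_dvd [Nontrivial (minGens S)] (hS : IsBettiDivisible S) {m : ℕ}
    {x y : factorizations S m} (hxy : ¬ (nabla S m).Reachable x y) {a : minGens S}
    (hxa : x.1 a ≠ 0) : cConst S a * a ∣ m := by
  rcases hS m (mem_betti_iff.2 ⟨x, y, hxy⟩) _ (cConst_mul_mem_betti a) with h | h
  · rw [← eq_cConst_mul_of_dvd (mem_factorizations.1 x.2) (mem_factorizations.1 y.2) hxa
      (by by_contra hya; exact hxy (reachable_of_common hxa hya)) (cConst_spec a).1 h]
  · exact h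

/-- In a Betti divisible semigroup, the multiplicity of `a` in the factorizations of a given element
is determined modulo `c_a`. -/
theorem IsBettiDivisible.modEq [Nontrivial (minGens S)] (hS : IsBettiDivisible S) (m : ℕ) :
    ∀ x y : minGens S →₀ ℕ, weight S x = m → weight S y = m →
      ∀ b : minGens S, x b ≡ y b [MOD cConst S b] := by
  induction m using Nat.strong_induction_on with | _ m ih
  -- A shared generator can be removed from both factorizations, which lowers `m`.
  have common : ∀ (x y : minGens S →₀ ℕ) (a : minGens S), weight S x = m → weight S y = m →
      x a ≠ 0 → y a ≠ 0 → ∀ b : minGens S, x b ≡ y b [MOD cConst S b] := by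
    intro x y a hx hy hxa hya b
    obtain ⟨x', rfl⟩ : ∃ x', x = Finsupp.single a 1 + x' :=
      exists_add_of_le (Finsupp.single_le_iff.2 (Nat.one_le_iff_ne_zero.2 hxa))
    obtain ⟨y', rfl⟩ : ∃ y', y = Finsupp.single a 1 + y' :=
      exists_add_of_le (Finsupp.single_le_iff.2 (Nat.one_le_iff_ne_zero.2 hya))
    rw [map_add, weight_single] at hx hy
    have ha := minGens_pos a
    exact (ih _ (by omega) x' y' rfl (by omega) b).add_left _
  intro x y hx hy b
  by_cases hr : (nabla S m).Reachable ⟨x, mem_factorizations.2 hx⟩ ⟨y, mem_factorizations.2 hy⟩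
  · obtain ⟨w⟩ := hr
    suffices H : ∀ (u v : factorizations S m), (nabla S m).Walk u v →
        u.1 b ≡ v.1 b [MOD cConst S b] from H _ _ w
    intro u v w
    induction w with
    | nil => exact Nat.ModEq.refl _
    | @cons u v w h _ ih' =>
      obtain ⟨-, a, hua, hva⟩ := (nabla_adj _ _).1 h
      exact (common _ _ a (mem_factorizations.1 u.2) (mem_factorizations.1 v.2) hua hva b).trans ih'
  -- If `u` uses `a`, then `c_a * a ∣ m`, so `u` shares `a` with a factorization by `a` alone, whose
  -- multiplicities are all 0 modulo the respective constants.
  · have aux : ∀ (u v : factorizations S m), ¬ (nabla S m).Reachable u v →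
        u.1 b ≡ 0 [MOD cConst S b] := by
      intro u v huv
      rcases eq_or_ne u.1 0 with h0 | h0
      · simp [h0, Nat.ModEq.refl]
      obtain ⟨a, ha⟩ := Finsupp.ne_iff.1 h0
      obtain ⟨k, hk⟩ := hS.cConst_mul_dvd huv ha
      have hk' : weight S (Finsupp.single a (cConst S a * k)) = m := by
        rw [weight_single, hk]; ring
      have hm : m ≠ 0 := by
        rintro rfl
        exact h0 (eq_zero_of_weight_eq_zero (mem_factorizations.1 u.2))
      refine (common _ _ a (mem_factorizations.1 u.2) hk' ha ?_ b).trans ?_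
      · rw [Finsupp.single_eq_same]
        rintro h
        rw [h] at hk'
        simp at hk'
        omega
      · by_cases hb : a = b
        · subst hb
          simp [Nat.modEq_zero_iff_dvd]
        · simp [Ne.symm hb, Nat.ModEq.refl]
    exact (aux _ _ hr).trans (aux _ _ fun h => hr h.symm).symm

/-- The number `a * b` is both `b` copies of `a` and `a` copies of `b`. -/
theorem IsBettiDivisible.cConst_dvd [Nontrivial (minGens S)] (hS : IsBettiDivisible S)
    {a b : minGens S} (hab : a ≠ b) : cConst S a ∣ b := by
  have h := hS.modEq (a * b) (Finsupp.single a (b : ℕ)) (Finsupp.single b (a : ℕ))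
    (by rw [weight_single, mul_comm]) (weight_single _ _) a
  simpa [hab, Nat.modEq_zero_iff_dvd] using h

theorem exists_weight_eq {m : ℕ} (hm : m ∈ S) : ∃ x, weight S x = m := by
  induction m using Nat.strong_induction_on with | _ m ih
  rcases eq_or_ne m 0 with rfl | h0
  · exact ⟨0, map_zero _⟩
  by_cases h : m ∈ minGens S
  · exact ⟨Finsupp.single ⟨m, h⟩ 1, by simp [weight_single]⟩
  · simp only [minGens, Set.mem_ofPred_eq, not_and, not_forall] at h
    obtain ⟨b, hb, c, hc, rfl, hbc⟩ := h hm h0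
    push Not at hbc
    obtain ⟨x, hx⟩ := ih b (by omega) hb
    obtain ⟨y, hy⟩ := ih c (by omega) hc
    exact ⟨x + y, by rw [map_add, hx, hy]⟩

theorem IsNumericalSemigroup.eq_one_of_dvd (hS : IsNumericalSemigroup S) {d : ℕ}
    (hd : ∀ a : minGens S, d ∣ a) : d = 1 := by
  have hdS : ∀ m ∈ S, d ∣ m := by
    intro m hm
    obtain ⟨x, rfl⟩ := exists_weight_eq hm
    rw [weight, Finsupp.linearCombination_apply]
    exact Finset.dvd_sum fun a _ => (hd a).mul_left _
  obtain ⟨N, hN⟩ := Set.Finite.bddAbove hS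
  have hmem : ∀ k, N < k → d ∣ k := fun k hk => hdS k <| by
    by_contra h
    exact absurd (hN h) (by omega)
  -- `d` divides two consecutive integers beyond all gaps of `S`.
  exact Nat.dvd_one.1 <| (Nat.dvd_add_right (hmem (N + 1) (by omega))).1 (hmem (N + 1 + 1) (by omega))

theorem IsBettiDivisible.coprime_cConst [Nontrivial (minGens S)] (hS : IsBettiDivisible S)
    (hS' : IsNumericalSemigroup S) (a : minGens S) : Nat.Coprime (cConst S a) a := by
  refine hS'.eq_one_of_dvd fun b => ?_
  by_cases h : a = b
  · exact h ▸ Nat.gcd_dvd_right _ _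
  · exact (Nat.gcd_dvd_left _ _).trans (hS.cConst_dvd h)

theorem weight_ne_zero_of_not_reachable {m : ℕ} {x y : factorizations S m}
    (h : ¬ (nabla S m).Reachable x y) : m ≠ 0 := by
  rintro rfl
  apply h
  rw [Subtype.ext ((eq_zero_of_weight_eq_zero (mem_factorizations.1 x.2)).trans
    (eq_zero_of_weight_eq_zero (mem_factorizations.1 y.2)).symm)]

theorem exists_ne_zero {m : ℕ} (hm : m ≠ 0) (x : factorizations S m) : ∃ a, x.1 a ≠ 0 := by
  by_contra! h
  have h0 : x.1 = 0 := Finsupp.ext h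
  apply hm
  rw [← mem_factorizations.1 x.2, h0, map_zero]

/-- The least Betti element of a Betti divisible semigroup is `c_a * a` for two minimal
generators `a`, and it divides all such products. -/
theorem IsBettiDivisible.exists_min [Nontrivial (minGens S)] (hS : IsBettiDivisible S) :
    ∃ a b : minGens S, a ≠ b ∧ cConst S a * a = cConst S b * b ∧
      ∀ d : minGens S, cConst S a * a ∣ cConst S d * d := by
  have hne : (betti S).Nonempty := by
    obtain ⟨a, -⟩ := exists_pair_ne (minGens S)
    exact ⟨_, cConst_mul_mem_betti a⟩
  have hm := Nat.sInf_mem hne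
  set m := sInf (betti S) with hm_def
  obtain ⟨x, y, hxy⟩ := mem_betti_iff.1 hm
  have hm0 := weight_ne_zero_of_not_reachable hxy
  have hdvd : ∀ d : minGens S, m ∣ cConst S d * d := by
    intro d
    have hd := cConst_mul_mem_betti d
    rcases hS m hm _ hd with h | h
    · exact h
    · rw [(Nat.le_of_dvd (Nat.pos_of_ne_zero hm0) h).antisymm (Nat.sInf_le hd)]
  obtain ⟨a, ha⟩ := exists_ne_zero hm0 x
  obtain ⟨b, hb⟩ := exists_ne_zero hm0 y
  have hya : y.1 a = 0 := by
    by_contra h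
    exact hxy (reachable_of_common ha h)
  have hxb : x.1 b = 0 := by
    by_contra h
    exact hxy (reachable_of_common h hb)
  have hx := mem_factorizations.1 x.2
  have hy := mem_factorizations.1 y.2
  have hma := eq_cConst_mul_of_dvd hx hy ha hya (cConst_spec a).1 (hdvd a)
  have hmb := eq_cConst_mul_of_dvd hy hx hb hxb (cConst_spec b).1 (hdvd b)
  refine ⟨a, b, ?_, hma ▸ hmb, hma ▸ hdvd⟩
  rintro rfl
  exact ha hxb

/-! ### From arithmetic conditions on `A` to the constants and the Betti elements. -/

section Converse

variable {A : minGens S → ℕ}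

/-- Modulo `A a` only the term of `a` survives in the weight, and `a` is invertible there. -/
theorem dvd_of_weight_eq (hcop : ∀ a, Nat.Coprime (A a) a)
    (hdvd : ∀ a b : minGens S, a ≠ b → A a ∣ b) {x : minGens S →₀ ℕ} {a : minGens S}
    (h : A a ∣ weight S x) : A a ∣ x a := by
  have h1 : A a ∣ weight S (x.erase a) := by
    rw [weight, Finsupp.linearCombination_apply]
    refine Finset.dvd_sum fun b hb => (hdvd a b ?_).mul_left _
    rintro rfl
    simp at hb
  rw [← weight_add_erase x a, Nat.dvd_add_left h1] at h
  exact (hcop a).dvd_of_dvd_mul_right h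

theorem dvd_weight_of_eq_zero (hdvd : ∀ a b : minGens S, a ≠ b → A a ∣ b)
    {x : minGens S →₀ ℕ} {a : minGens S} (h : x a = 0) : A a ∣ weight S x := by
  rw [weight, Finsupp.linearCombination_apply]
  refine Finset.dvd_sum fun b hb => (hdvd a b ?_).mul_left _
  rintro rfl
  exact Finsupp.mem_support_iff.1 hb h

theorem eq_cConst [Nontrivial (minGens S)] (hpos : ∀ a, 0 < A a)
    (hcop : ∀ a, Nat.Coprime (A a) a) (hdvd : ∀ a b : minGens S, a ≠ b → A a ∣ b)
    (hex : ∀ a, ∃ b, b ≠ a ∧ A b * b ∣ A a * a) (a : minGens S) : A a = cConst S a := by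
  apply le_antisymm
  · obtain ⟨hc, y, hy, hya⟩ := cConst_spec a
    refine Nat.le_of_dvd hc ((hcop a).dvd_of_dvd_mul_right ?_)
    exact hy ▸ dvd_weight_of_eq_zero hdvd hya
  · obtain ⟨b, hb, k, hk⟩ := hex a
    refine cConst_le (hpos a) (x := Finsupp.single b (A b * k)) ?_ (by simp [hb.symm])
    rw [weight_single, hk]
    ring

theorem betti_eq_range [Nontrivial (minGens S)] (hpos : ∀ a, 0 < A a)
    (hcop : ∀ a, Nat.Coprime (A a) a) (hdvd : ∀ a b : minGens S, a ≠ b → A a ∣ b)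
    (hex : ∀ a, ∃ b, b ≠ a ∧ A b * b ∣ A a * a)
    (htot : ∀ a b : minGens S, A a * a ∣ A b * b ∨ A b * b ∣ A a * a) :
    betti S = Set.range fun a : minGens S => A a * a := by
  ext m
  constructor
  · intro hm
    obtain ⟨x, y, hxy⟩ := mem_betti_iff.1 hm
    have hm0 := weight_ne_zero_of_not_reachable hxy
    obtain ⟨a, ha⟩ := exists_ne_zero hm0 x
    obtain ⟨b, hb⟩ := exists_ne_zero hm0 y
    have main : ∀ (x y : factorizations S m) (a b : minGens S), ¬ (nabla S m).Reachable x y →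
        x.1 a ≠ 0 → y.1 b ≠ 0 → A a * a ∣ A b * b → A b * b = m := by
      intro x y a b hxy ha hb hab
      obtain ⟨k, hk⟩ := hab
      have hxb : x.1 b = 0 := by
        by_contra h
        exact hxy (reachable_of_common h hb)
      have hyb : A b ∣ y.1 b := by
        apply dvd_of_weight_eq hcop hdvd
        rw [mem_factorizations.1 y.2, ← mem_factorizations.1 x.2]
        exact dvd_weight_of_eq_zero hdvd hxb
      obtain ⟨y', hy'⟩ := exists_add_of_le
        (Finsupp.single_le_iff.2 (Nat.le_of_dvd (Nat.pos_of_ne_zero hb) hyb))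
      have hy := mem_factorizations.1 y.2
      rw [hy', map_add, weight_single] at hy
      -- Trading `A b` copies of `b` in `y` for copies of `a` gives a factorization meeting `x` in
      -- `a` and `y` in `y'`. It would connect `x` to `y` unless `y' = 0`.
      have hz : weight S (Finsupp.single a (A a * k) + y') = m := by
        rw [map_add, weight_single, ← hy, hk]
        ring
      have hk0 : k ≠ 0 := by
        rintro rfl
        have := Nat.mul_pos (hpos b) (minGens_pos b)
        omega
      have hxz : (nabla S m).Reachable x ⟨_, mem_factorizations.2 hz⟩ :=
        reachable_of_common (a := a) ha (by simp [(hpos a).ne', hk0])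
      have hy0 : y' = 0 := by
        by_contra h
        obtain ⟨d, hd⟩ := Finsupp.ne_iff.1 h
        have hd : y' d ≠ 0 := hd
        refine hxy (hxz.trans (reachable_of_common (a := d) ?_ ?_))
        · simp [hd]
        · simp [hy', hd]
      simpa [hy0] using hy
    rcases htot a b with h | h
    · exact ⟨b, main x y a b hxy ha hb h⟩
    · exact ⟨a, main y x b a (fun h => hxy h.symm) hb ha h⟩
  · rintro ⟨a, rfl⟩
    simp only [eq_cConst hpos hcop hdvd hex a]
    exact cConst_mul_mem_betti a

end Converse

theorem betti_eq_empty [Subsingleton (minGens S)] : betti S = ∅ := by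
  refine Set.eq_empty_of_forall_notMem fun m hm => ?_
  obtain ⟨x, y, hxy⟩ := mem_betti_iff.1 hm
  have hm0 := weight_ne_zero_of_not_reachable hxy
  obtain ⟨a, ha⟩ := exists_ne_zero hm0 x
  obtain ⟨b, hb⟩ := exists_ne_zero hm0 y
  exact hxy (reachable_of_common ha (Subsingleton.elim b a ▸ hb))

/-! ### Translation to indexed generators, and both directions of the equivalence. -/

section Arrangement

variable {e : ℕ} {n : Fin e → ℕ}

/-- The indexing of the minimal generators given by an arrangement. -/
noncomputable def IsArrangement.equiv (hn : IsArrangement S n) : Fin e ≃ minGens S :=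
  (Equiv.ofInjective n hn.1).trans (Equiv.setCongr hn.2)

@[simp] theorem IsArrangement.coe_equiv (hn : IsArrangement S n) (i : Fin e) : (hn.equiv i : ℕ) = n i :=
  rfl

theorem IsArrangement.nontrivial (hn : IsArrangement S n) (he : 2 ≤ e) :
    Nontrivial (minGens S) :=
  have : Nontrivial (Fin e) := Fin.nontrivial_iff_two_le.2 he
  hn.equiv.symm.nontrivial

theorem IsArrangement.subsingleton (hn : IsArrangement S n) (he : e ≤ 1) :
    Subsingleton (minGens S) :=
  have : Subsingleton (Fin e) := Fin.subsingleton_iff_le_one.2 he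
  hn.equiv.symm.subsingleton

variable {a f : Fin e → ℕ}

theorem IsBettiDivisibleData.mul_eq (h : IsBettiDivisibleData n a f) (i : Fin e) :
    a i * n i = f i * ∏ j, a j := by
  rw [h.n_eq, mul_left_comm, Nat.mul_div_cancel' (Finset.dvd_prod_of_mem a (Finset.mem_univ i))]

theorem IsBettiDivisibleData.n_eq_prod_erase (h : IsBettiDivisibleData n a f) (i : Fin e) :
    n i = f i * ∏ j ∈ Finset.univ.erase i, a j := by
  rw [h.n_eq, ← Finset.mul_prod_erase _ _ (Finset.mem_univ i), Nat.mul_div_cancel_left _ (h.a_pos i)]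

theorem IsBettiDivisibleData.dvd_n (h : IsBettiDivisibleData n a f) {i j : Fin e} (hij : i ≠ j) :
    a i ∣ n j := by
  rw [h.n_eq_prod_erase]
  exact (Finset.dvd_prod_of_mem a (Finset.mem_erase.2 ⟨hij, Finset.mem_univ i⟩)).mul_left _

theorem IsBettiDivisibleData.coprime_n (h : IsBettiDivisibleData n a f) (i : Fin e) :
    Nat.Coprime (a i) (n i) := by
  rw [h.n_eq_prod_erase]
  exact (h.coprime_f_a i).symm.mul_right <| Nat.Coprime.prod_right fun j hj =>
    h.pairwise_coprime i j (Finset.ne_of_mem_erase hj).symm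

/-- Indices 0 and 1 both give the product `∏ a j`, which divides all the others; one of them differs
from `i`. -/
theorem IsBettiDivisibleData.exists_ne_dvd (h : IsBettiDivisibleData n a f) (he : 2 ≤ e)
    (i : Fin e) : ∃ j, j ≠ i ∧ a j * n j ∣ a i * n i := by
  have key : ∀ j : Fin e, (j : ℕ) ≤ 1 → a j * n j ∣ a i * n i := by
    intro j hj
    rw [h.mul_eq, h.mul_eq, h.f_first j hj, one_mul]
    exact dvd_mul_left _ _
  by_cases hi : (i : ℕ) = 0
  · exact ⟨⟨1, by omega⟩, fun h => by simp [← h] at hi, key _ le_rfl⟩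
  · exact ⟨⟨0, by omega⟩, fun h => hi (by simp [← h]), key _ zero_le_one⟩

theorem IsBettiDivisibleData.total (h : IsBettiDivisibleData n a f) (i j : Fin e) :
    a i * n i ∣ a j * n j ∨ a j * n j ∣ a i * n i := by
  rw [h.mul_eq, h.mul_eq]
  exact (le_total i j).imp (fun hij => mul_dvd_mul_right (h.f_chain i j hij) _)
    fun hij => mul_dvd_mul_right (h.f_chain j i hij) _

theorem IsBettiDivisibleData.eq_cConst (h : IsBettiDivisibleData n a f) (hn : IsArrangement S n)
    (he : 2 ≤ e) (i : Fin e) : a i = cConst S (n i) := by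
  have := hn.nontrivial he
  have h1 := NumSgp.eq_cConst (S := S) (A := a ∘ hn.equiv.symm)
    (hn.equiv.forall_congr_right.1 fun i => by simpa using h.a_pos i)
    (hn.equiv.forall_congr_right.1 fun i => by simpa using h.coprime_n i)
    (hn.equiv.forall_congr_right.1 fun i => hn.equiv.forall_congr_right.1 fun j => by
      simpa using fun hij => h.dvd_n hij)
    (hn.equiv.forall_congr_right.1 fun i => by
      obtain ⟨j, hj, hd⟩ := h.exists_ne_dvd he i
      exact ⟨hn.equiv j, by simpa using hj, by simpa using hd⟩) (hn.equiv i)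
  simpa using h1

theorem IsBettiDivisibleData.betti_eq (h : IsBettiDivisibleData n a f) (hn : IsArrangement S n) :
    betti S = {b | ∃ i : Fin e, 1 ≤ (i : ℕ) ∧ b = f i * ∏ j, cConst S (n j)} := by
  rcases Nat.lt_or_ge e 2 with he | he
  · have := hn.subsingleton (by omega)
    rw [betti_eq_empty]
    refine (Set.eq_empty_of_forall_notMem ?_).symm
    rintro b ⟨i, hi, -⟩
    omega
  have := hn.nontrivial he
  simp only [← h.eq_cConst hn he]
  rw [betti_eq_range (S := S) (A := a ∘ hn.equiv.symm)
    (hn.equiv.forall_congr_right.1 fun i => by simpa using h.a_pos i)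
    (hn.equiv.forall_congr_right.1 fun i => by simpa using h.coprime_n i)
    (hn.equiv.forall_congr_right.1 fun i => hn.equiv.forall_congr_right.1 fun j => by
      simpa using fun hij => h.dvd_n hij)
    (hn.equiv.forall_congr_right.1 fun i => by
      obtain ⟨j, hj, hd⟩ := h.exists_ne_dvd he i
      exact ⟨hn.equiv j, by simpa using hj, by simpa using hd⟩)
    (hn.equiv.forall_congr_right.1 fun i => hn.equiv.forall_congr_right.1 fun j => by
      simpa using h.total i j)]
  ext b
  rw [Set.mem_range, ← hn.equiv.exists_congr_right]
  simp only [Function.comp_apply, Equiv.symm_apply_apply, hn.coe_equiv, h.mul_eq,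
    Set.mem_ofPred_eq]
  constructor
  · rintro ⟨i, rfl⟩
    by_cases hi : 1 ≤ (i : ℕ)
    · exact ⟨i, hi, rfl⟩
    -- Index 0 contributes the same element as index 1, so omitting it from the set loses nothing.
    · refine ⟨⟨1, by omega⟩, le_rfl, ?_⟩
      rw [h.f_first i (by omega), h.f_first _ le_rfl]
  · rintro ⟨i, -, rfl⟩
    exact ⟨i, rfl⟩

theorem IsBettiDivisibleData.isBettiDivisible (h : IsBettiDivisibleData n a f)
    (hn : IsArrangement S n) : IsBettiDivisible S := by
  rw [IsBettiDivisible, h.betti_eq hn]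
  rintro _ ⟨i, -, rfl⟩ _ ⟨j, -, rfl⟩
  exact (le_total i j).imp (fun hij => mul_dvd_mul_right (h.f_chain i j hij) _)
    fun hij => mul_dvd_mul_right (h.f_chain j i hij) _

theorem isBettiDivisibleData_one (hS : IsNumericalSemigroup S) (hn : IsArrangement S n)
    (he : e ≤ 1) : IsBettiDivisibleData n 1 1 where
  a_pos := by simp
  f_pos := by simp
  pairwise_coprime := by simp
  f_first := by simp
  f_chain := by simp
  coprime_f_a := by simp
  n_eq i := by
    have := hn.subsingleton he
    simpa using hS.eq_one_of_dvd (d := n i) fun b => by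
      rw [← Subsingleton.elim (hn.equiv i) b, hn.coe_equiv]

theorem IsBettiDivisible.exists_data (hS' : IsBettiDivisible S) (hS : IsNumericalSemigroup S)
    (hn : IsArrangement S n) (he : 2 ≤ e)
    (hc : ∀ i j : Fin e, i ≤ j → cConst S (n i) * n i ≤ cConst S (n j) * n j) :
    ∃ a f : Fin e → ℕ, IsBettiDivisibleData n a f := by
  have := hn.nontrivial he
  set c : Fin e → ℕ := fun i => cConst S (n i) with hc_def
  have hpos : ∀ i, 0 < c i := fun i => (cConst_spec (hn.equiv i)).1
  have hnpos : ∀ i, 0 < n i := fun i => minGens_pos (hn.equiv i)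
  have hcop : ∀ i, Nat.Coprime (c i) (n i) := fun i => hS'.coprime_cConst hS (hn.equiv i)
  have hdvd : ∀ i j, i ≠ j → c i ∣ n j := fun i j hij =>
    hS'.cConst_dvd (a := hn.equiv i) (b := hn.equiv j) (by simpa using hij)
  have hcc : ∀ i j, i ≠ j → Nat.Coprime (c i) (c j) := fun i j hij =>
    (hcop i).coprime_dvd_right (hdvd j i hij.symm)
  have hprod : ∀ i, ∏ j ∈ Finset.univ.erase i, c j ∣ n i := fun i =>
    Finset.prod_dvd_of_isRelPrime (fun j _ k _ hjk => Nat.coprime_iff_isRelPrime.1 (hcc j k hjk))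
      fun j hj => hdvd j i (Finset.ne_of_mem_erase hj)
  choose f hf using hprod
  have hfP : ∀ i, c i * n i = f i * ∏ j, c j := by
    intro i
    rw [hf i, ← Finset.mul_prod_erase _ _ (Finset.mem_univ i)]
    ring
  have hP : 0 < ∏ j, c j := Finset.prod_pos fun j _ => hpos j
  have hfn : ∀ i, f i ∣ n i := fun i => hf i ▸ dvd_mul_left _ _
  have hfpos : ∀ i, 0 < f i := fun i => Nat.pos_of_dvd_of_pos (hfn i) (hnpos i)
  have hchain : ∀ i j, i ≤ j → f i ∣ f j := by
    intro i j hij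
    refine Nat.dvd_of_mul_dvd_mul_right hP ?_
    rw [← hfP, ← hfP]
    rcases hS' _ (cConst_mul_mem_betti (hn.equiv i)) _ (cConst_mul_mem_betti (hn.equiv j))
      with h | h
    · exact h
    -- Divisibility against the order of the arrangement forces equality.
    · have h1 := Nat.le_of_dvd (Nat.mul_pos (hpos i) (hnpos i)) h
      have h2 : c i * n i = c j * n j := (hc i j hij).antisymm h1
      rw [h2]
  obtain ⟨p, q, hpq, hpq', hmin⟩ := hS'.exists_min
  obtain ⟨i, rfl⟩ := hn.equiv.surjective p
  obtain ⟨j, rfl⟩ := hn.equiv.surjective q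
  have hij : i ≠ j := fun h => hpq (by rw [h])
  have heq : c i * n i = c j * n j := hpq'
  have hfirst : ∀ k : Fin e, (k : ℕ) ≤ 1 → f k = 1 := by
    intro k hk
    -- Since `i ≠ j` and `k ≤ 1`, at least one of `i`, `j` is `≥ k`, and both attain the minimum.
    have hk1 : c k * n k ≤ c i * n i := by
      by_cases hi : k ≤ i
      · exact hc k i hi
      · exact heq ▸ hc k j (by
          rw [Fin.le_def] at hi ⊢
          have := Fin.val_ne_of_ne hij
          omega)
    have hk2 : c i * n i = c k * n k :=
      (Nat.le_of_dvd (Nat.mul_pos (hpos k) (hnpos k)) (hmin (hn.equiv k))).antisymm hk1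
    -- By minimality `f k ∣ f l ∣ n l` for all `l`, and the generators have gcd 1.
    refine hS.eq_one_of_dvd (hn.equiv.forall_congr_right.1 fun l => ?_)
    refine dvd_trans (Nat.dvd_of_mul_dvd_mul_right hP ?_) (hfn l)
    rw [← hfP, ← hfP, ← hk2]
    exact hmin (hn.equiv l)
  exact ⟨c, f, hpos, hfpos, hcc, hfirst, hchain,
    fun i => ((hcop i).coprime_dvd_right (hfn i)).symm, fun i => by
      rw [← Finset.mul_prod_erase _ _ (Finset.mem_univ i), Nat.mul_div_cancel_left _ (hpos i),
        mul_comm, ← hf i]⟩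

end Arrangement

end NumSgp

theorem mainTheorem2 (S : AddSubmonoid ℕ) (hS : NumSgp.IsNumericalSemigroup S)
    (e : ℕ) (n : Fin e → ℕ) (hn : NumSgp.IsArrangement S n)
    (hc : ∀ i j : Fin e, i ≤ j →
      NumSgp.cConst S (n i) * n i ≤ NumSgp.cConst S (n j) * n j) :
    (NumSgp.IsBettiDivisible S ↔ ∃ a f : Fin e → ℕ, NumSgp.IsBettiDivisibleData n a f) ∧
    ∀ a f : Fin e → ℕ, NumSgp.IsBettiDivisibleData n a f →
      (2 ≤ e → ∀ i, a i = NumSgp.cConst S (n i)) ∧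
      NumSgp.betti S =
        {b | ∃ i : Fin e, 1 ≤ (i : ℕ) ∧ b = f i * ∏ j, NumSgp.cConst S (n j)} := by
  refine ⟨⟨fun h => ?_, fun ⟨a, f, h⟩ => h.isBettiDivisible hn⟩,
    fun a f h => ⟨h.eq_cConst hn, h.betti_eq hn⟩⟩
  rcases Nat.lt_or_ge e 2 with he | he
  · exact ⟨1, 1, NumSgp.isBettiDivisibleData_one hS hn (by omega)⟩
  · exact h.exists_data hS hn he hc
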